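/- An overpartition of a nonnegative integer $n$ is a partition of $n$ in which the first occurrence of each distinct part may be overlined. Let $\overline{SOME}(n)$ denote the sum, over all overpartitions $\lambda$ of $n$, of the sum of the odd parts of $\lambda$ minus the sum of the even parts of $\lambda$ (parts counted with multiplicity, whether overlined or not). Then for every integer $n \ge 0$, $$\overline{SOME}(4n+3) \equiv 0 \pmod 8 \qquad\text{and}\qquad \overline{SOME}(8n+7) \equiv 0 \pmod{64}.$$ -/

import Mathlib

/-- An overpartition of `n`: a partition of `n` in which the first occurrence of each distinct part
may be overlined. It is recorded by the underlying partition together with the set of those part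
sizes whose first occurrence is overlined. -/
@[ext]
structure Overpartition (n : ℕ) where
  /-- the partition of `n` obtained by forgetting the overlines -/
  partition : n.Partition
  /-- the part sizes whose first occurrence is overlined -/
  overlined : Finset ℕ
  /-- only parts that occur can be overlined -/
  overlined_subset : overlined ⊆ partition.parts.toFinset

namespace Overpartition

/-- An overpartition is the same as a partition with a subset of its set of part sizes. -/
def equivSigma (n : ℕ) :
    (Σ p : n.Partition, {s : Finset ℕ // s ∈ p.parts.toFinset.powerset}) ≃ Overpartition n where
  toFun x := ⟨x.1, x.2.1, Finset.mem_powerset.1 x.2.2⟩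
  invFun l := ⟨l.partition, l.overlined, Finset.mem_powerset.2 l.overlined_subset⟩
  left_inv _ := rfl
  right_inv _ := rfl

instance instFintype (n : ℕ) : Fintype (Overpartition n) :=
  Fintype.ofEquiv _ (equivSigma n)

variable {n : ℕ}

/-- The sum of the odd parts (overlined or not), with multiplicity. -/
def sumOddParts (l : Overpartition n) : ℕ :=
  (l.partition.parts.filter (fun i => Odd i)).sum

/-- The sum of the even parts (overlined or not), with multiplicity. -/
def sumEvenParts (l : Overpartition n) : ℕ :=
  (l.partition.parts.filter (fun i => Even i)).sum

end Overpartition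

/-- The sum, over all overpartitions of `n`, of the sum of the odd parts minus the sum of the
even parts. -/
def overlineSOME (n : ℕ) : ℤ :=
  ∑ l : Overpartition n, ((l.sumOddParts : ℤ) - (l.sumEvenParts : ℤ))

/-! Let O and E generate overpartitions with only odd and only even parts, D = X d/dX, and S
generate `overlineSOME`. Then S = DO·E - O·DE. Gauss's identity says O E θ(-X) = 1. Since O(X)O(-X)
= 1 and E is even, replacing X by -X gives O = θ E, whence S = Dθ·E² and S θ(X)θ(-X) = Dθ
(`mk_overlineSOME_mul_thetaSeries`).

The congruences follow by dissecting θ = a + 2b, with a and b collecting the even and odd squares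
(`dvd_coeff_of_dissection`). Here θ(X)θ(-X) = a² - 4b². Multiplying by a² + 4b² turns the
denominator into a⁴ - 16b⁴, a series in X⁴, and the only part of the numerator with exponents 3 mod
4 is 8·Db·b². One more conjugation makes the denominator a series in X⁸ and leaves a multiple of 64
in the class 7 mod 8. -/

open PowerSeries

/-! ### Gauss's identity through a Rogers–Fine series -/

/-- The inverse of `1 + X ^ k` for `0 < k`. -/
noncomputable def invOneAddXPow (k : ℕ) : ℤ⟦X⟧ := invOfUnit (1 + X ^ k) 1

theorem one_add_X_pow_mul_inv {k : ℕ} (hk : k ≠ 0) :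
    (1 + X ^ k) * invOneAddXPow k = 1 :=
  mul_invOfUnit _ _ (by simp [hk])

/-- The general term of the Rogers–Fine series
`∑ X ^ (m * k) (X ^ m; X)_k / (-X ^ m; X)_{k + 1}`. -/
noncomputable def gaussTerm (m k : ℕ) : ℤ⟦X⟧ :=
  X ^ (m * k) * (∏ i ∈ Finset.range k, (1 - X ^ (m + i))) *
    ∏ i ∈ Finset.range (k + 1), invOneAddXPow (m + i)

theorem gaussTerm_succ_right (m k : ℕ) :
    gaussTerm m (k + 1) * (1 + X ^ (m + k + 1)) =
      gaussTerm m k * (X ^ m * (1 - X ^ (m + k))) := by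
  have h := one_add_X_pow_mul_inv (k := m + k + 1) (by omega)
  simp only [gaussTerm]
  rw [Finset.prod_range_succ _ (k + 1), Finset.prod_range_succ _ k, mul_add, pow_add, mul_one,
    ← add_assoc m k 1]
  linear_combination (X ^ (m * k) * X ^ m *
    ((∏ i ∈ Finset.range k, (1 - X ^ (m + i))) * (1 - X ^ (m + k))) *
    ∏ i ∈ Finset.range (k + 1), invOneAddXPow (m + i)) * h

theorem gaussTerm_succ_left {m : ℕ} (hm : m ≠ 0) (k : ℕ) :
    gaussTerm (m + 1) k * ((1 - X ^ m) * (1 + X ^ (m + k + 1))) =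
      gaussTerm m k * (X ^ k * (1 - X ^ (m + k)) * (1 + X ^ m)) := by
  have h := one_add_X_pow_mul_inv hm
  have h' := one_add_X_pow_mul_inv (k := m + k + 1) (by omega)
  have e1 : (∏ i ∈ Finset.range k, (1 - X ^ (m + 1 + i)) : ℤ⟦X⟧) * (1 - X ^ m) =
      (∏ i ∈ Finset.range k, (1 - X ^ (m + i))) * (1 - X ^ (m + k)) := by
    rw [← Finset.prod_range_succ, Finset.prod_range_succ']
    simp [add_assoc, add_comm 1]
  have e2 : (∏ i ∈ Finset.range (k + 1), invOneAddXPow (m + 1 + i)) * invOneAddXPow m =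
      (∏ i ∈ Finset.range (k + 1), invOneAddXPow (m + i)) * invOneAddXPow (m + k + 1) := by
    rw [add_assoc m k 1, ← Finset.prod_range_succ _ (k + 1), Finset.prod_range_succ' _ (k + 1)]
    simp [add_assoc, add_comm 1]
  have e3 : (∏ i ∈ Finset.range (k + 1), invOneAddXPow (m + 1 + i)) * (1 + X ^ (m + k + 1)) =
      (∏ i ∈ Finset.range (k + 1), invOneAddXPow (m + i)) * (1 + X ^ m) := by
    linear_combination (-(∏ i ∈ Finset.range (k + 1), invOneAddXPow (m + 1 + i)) *
      (1 + X ^ (m + k + 1))) * h + (1 + X ^ (m + k + 1)) * (1 + X ^ m) * e2 +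
      (∏ i ∈ Finset.range (k + 1), invOneAddXPow (m + i)) * (1 + X ^ m) * h'
  simp only [gaussTerm]
  rw [add_mul, pow_add, one_mul]
  linear_combination (X ^ (m * k) * X ^ k *
    (∏ i ∈ Finset.range (k + 1), invOneAddXPow (m + 1 + i)) * (1 + X ^ (m + k + 1))) * e1 +
    X ^ (m * k) * X ^ k *
      ((∏ i ∈ Finset.range k, (1 - X ^ (m + i))) * (1 - X ^ (m + k))) * e3

theorem one_add_X_pow_ne_zero {k : ℕ} (hk : k ≠ 0) : (1 + X ^ k : ℤ⟦X⟧) ≠ 0 :=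
  left_ne_zero_of_mul_eq_one (one_add_X_pow_mul_inv hk)

/-- The partial sums of the Rogers–Fine series. -/
noncomputable def gaussPartialSum (K m : ℕ) : ℤ⟦X⟧ := ∑ k ∈ Finset.range K, gaussTerm m k

/-- A truncated form, with exact remainder, of the functional equation G(m) = 1 - X^(2m+1) G(m+1) of
the full series. The factor 1 - X^m clears the denominator that relates the terms for m + 1 to those
for m. -/
theorem gaussPartialSum_telescope {m : ℕ} (hm : m ≠ 0) (K : ℕ) :
    (1 - X ^ m) * (1 - (gaussPartialSum K m + X ^ (2 * m + 1) * gaussPartialSum K (m + 1))) =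
      gaussTerm m K * (1 - X ^ (2 * m + K)) := by
  induction K with
  | zero =>
    have h := one_add_X_pow_mul_inv hm
    simp only [gaussPartialSum, gaussTerm, Finset.range_zero, Finset.sum_empty, Finset.prod_empty,
      zero_add, Finset.prod_range_one, add_zero, mul_zero, pow_zero, mul_comm 2 m, pow_mul]
    linear_combination (-(1 - X ^ m)) * h
  | succ K ih =>
    apply mul_right_cancel₀ (one_add_X_pow_ne_zero (k := m + K + 1) (by omega))
    have h1 := gaussTerm_succ_right m K
    have h2 := gaussTerm_succ_left hm K
    simp only [gaussPartialSum, Finset.sum_range_succ] at ih ⊢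
    linear_combination (1 + X ^ (m + K + 1)) * ih - (1 - X ^ (2 * m + (K + 1))) * h1 -
      X ^ (2 * m + 1) * h2

theorem X_pow_dvd_gaussTerm {m : ℕ} (hm : m ≠ 0) (K : ℕ) : X ^ K ∣ gaussTerm m K := by
  rw [gaussTerm, mul_assoc]
  exact (pow_dvd_pow X (Nat.le_mul_of_pos_left K (Nat.pos_of_ne_zero hm))).mul_right _

theorem X_pow_dvd_gaussPartialSum_functional {m : ℕ} (hm : m ≠ 0) (K : ℕ) :
    X ^ K ∣ 1 - (gaussPartialSum K m + X ^ (2 * m + 1) * gaussPartialSum K (m + 1)) := by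
  refine X_prime.pow_dvd_of_dvd_mul_left K (a := (1 - X ^ m : ℤ⟦X⟧)) ?_ ?_
  · rw [X_dvd_iff]
    simp [hm]
  · rw [gaussPartialSum_telescope hm]
    exact (X_pow_dvd_gaussTerm hm K).mul_right _

/-- Iterates the functional equation from m = 1; the exponents 3, 5, ..., 2J + 1 add up to J² + 2J.
-/
theorem X_pow_dvd_gaussPartialSum_iterate (K J : ℕ) :
    X ^ K ∣ gaussPartialSum K 1 - (∑ j ∈ Finset.range J, (-1) ^ j * X ^ (j ^ 2 + 2 * j) +
      (-1) ^ J * X ^ (J ^ 2 + 2 * J) * gaussPartialSum K (J + 1)) := by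
  induction J with
  | zero => simp
  | succ J ih =>
    have h := (X_pow_dvd_gaussPartialSum_functional (m := J + 1) (by omega) K).mul_left
      ((-1) ^ J * X ^ (J ^ 2 + 2 * J))
    convert! dvd_sub ih h using 1
    rw [Finset.sum_range_succ]
    ring

theorem X_pow_dvd_gaussPartialSum_one_sub (K : ℕ) :
    X ^ K ∣ gaussPartialSum K 1 - ∑ j ∈ Finset.range K, (-1) ^ j * X ^ (j ^ 2 + 2 * j) := by
  have h : (X : ℤ⟦X⟧) ^ K ∣ (-1) ^ K * X ^ (K ^ 2 + 2 * K) * gaussPartialSum K (K + 1) :=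
    ((pow_dvd_pow X (by nlinarith)).mul_left _).mul_right _
  convert! dvd_add (X_pow_dvd_gaussPartialSum_iterate K K) h using 1
  ring

/-- Passing from N to N + 1 factors changes the product by -2X^(N+1)/(1 + X^(N+1)) times itself,
which is -2X times the N-th series term at m = 1. -/
theorem prod_one_sub_mul_inv_eq (N : ℕ) :
    ∏ i ∈ Finset.range N, ((1 - X ^ (i + 1)) * invOneAddXPow (i + 1)) =
      1 - 2 * X * gaussPartialSum N 1 := by
  induction N with
  | zero => simp [gaussPartialSum]
  | succ N ih =>
    have h := one_add_X_pow_mul_inv (k := N + 1) (by omega)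
    have e : gaussTerm 1 N = X ^ N * invOneAddXPow (N + 1) *
        ∏ i ∈ Finset.range N, ((1 - X ^ (i + 1)) * invOneAddXPow (i + 1)) := by
      simp only [gaussTerm, Finset.prod_range_succ, Finset.prod_mul_distrib, add_comm 1, one_mul]
      ring
    rw [Finset.prod_range_succ, gaussPartialSum, Finset.sum_range_succ, ← gaussPartialSum, e,
      mul_add, ← sub_sub, ← ih]
    linear_combination
      (∏ i ∈ Finset.range N, ((1 - X ^ (i + 1)) * invOneAddXPow (i + 1))) * h

/-- The power series `∑ X ^ (k ^ 2)` over the positive integers `k` with `P k`. -/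
noncomputable def squareSeries (P : ℕ → Prop) : ℤ⟦X⟧ := by
  classical exact PowerSeries.mk fun n ↦ if ∃ k, 0 < k ∧ P k ∧ k ^ 2 = n then 1 else 0

/-- The theta series `∑ X ^ (k ^ 2)` over all integers `k`. -/
noncomputable def thetaSeries : ℤ⟦X⟧ := 1 + 2 * squareSeries fun _ ↦ True

theorem coeff_sum_neg_one_pow_mul_X_pow_sq {n N : ℕ} (hn : n ≤ N) :
    coeff n (∑ j ∈ Finset.range N, (-1) ^ (j + 1) * X ^ ((j + 1) ^ 2) : ℤ⟦X⟧) =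
      (-1) ^ n * coeff n (squareSeries fun _ ↦ True) := by
  classical
  have hC (j : ℕ) : ((-1) ^ (j + 1) * X ^ ((j + 1) ^ 2) : ℤ⟦X⟧) =
      C ((-1) ^ (j + 1)) * X ^ ((j + 1) ^ 2) := by simp
  simp only [hC, map_sum, coeff_C_mul, coeff_X_pow, squareSeries, coeff_mk, true_and]
  split_ifs with h
  · obtain ⟨k, hk, rfl⟩ := h
    rw [Finset.sum_eq_single (k - 1)]
    -- The signs agree because k and k² have the same parity.
    · rcases Nat.even_or_odd k with h | h
      · simp [Nat.sub_add_cancel hk, h.neg_one_pow, (h.pow_of_ne_zero two_ne_zero).neg_one_pow]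
      · simp [Nat.sub_add_cancel hk, h.neg_one_pow, h.pow.neg_one_pow]
    · intro j _ hj
      rw [if_neg, mul_zero]
      intro e
      have := Nat.pow_left_injective (n := 2) (by norm_num) e
      omega
    · intro hk'
      exfalso
      apply hk'
      rw [Finset.mem_range]
      nlinarith [Nat.sub_add_cancel hk]
  · rw [mul_zero]
    refine Finset.sum_eq_zero fun j _ ↦ ?_
    rw [if_neg, mul_zero]
    exact fun e ↦ h ⟨j + 1, by omega, e.symm⟩

theorem coeff_prod_one_sub_mul_inv {n N : ℕ} (hn : n < N) :
    coeff n (∏ i ∈ Finset.range N, ((1 - X ^ (i + 1)) * invOneAddXPow (i + 1))) =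
      coeff n (rescale (-1) thetaSeries) := by
  have h := (X_pow_dvd_gaussPartialSum_one_sub N).mul_left (2 * X)
  have e : 2 * X * (gaussPartialSum N 1 - ∑ j ∈ Finset.range N, (-1) ^ j * X ^ (j ^ 2 + 2 * j)) =
      (1 + C 2 * ∑ j ∈ Finset.range N, (-1) ^ (j + 1) * X ^ ((j + 1) ^ 2)) -
        ∏ i ∈ Finset.range N, ((1 - X ^ (i + 1)) * invOneAddXPow (i + 1)) := by
    rw [prod_one_sub_mul_inv_eq, mul_sub, Finset.mul_sum, Finset.mul_sum, map_ofNat,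
      add_sub_sub_cancel, add_comm, sub_eq_add_neg, ← Finset.sum_neg_distrib]
    congr 1
    exact Finset.sum_congr rfl fun j _ ↦ by ring
  rw [e, X_pow_dvd_iff] at h
  have h := h n hn
  rw [map_sub, sub_eq_zero] at h
  rw [← h, map_add, coeff_C_mul, coeff_sum_neg_one_pow_mul_X_pow_sq hn.le, thetaSeries,
    coeff_rescale, ← map_ofNat C 2, map_add, coeff_C_mul, coeff_one]
  split_ifs with h0
  · simp [h0]
  · ring

/-! ### Series supported in one residue class -/

/-- All exponents occurring in `f` are congruent to `r` modulo `m`. -/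
def SupportedMod (m : ℕ) (r : ZMod m) (f : ℤ⟦X⟧) : Prop :=
  ∀ n : ℕ, (n : ZMod m) ≠ r → coeff n f = 0

namespace SupportedMod

variable {m : ℕ} {r s : ZMod m} {f g : ℤ⟦X⟧}

theorem add (hf : SupportedMod m r f) (hg : SupportedMod m r g) : SupportedMod m r (f + g) :=
  fun n hn ↦ by rw [map_add, hf n hn, hg n hn, add_zero]

theorem neg (hf : SupportedMod m r f) : SupportedMod m r (-f) :=
  fun n hn ↦ by rw [map_neg, hf n hn, neg_zero]

theorem sub (hf : SupportedMod m r f) (hg : SupportedMod m r g) : SupportedMod m r (f - g) :=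
  sub_eq_add_neg f g ▸ hf.add hg.neg

theorem mul (hf : SupportedMod m r f) (hg : SupportedMod m s g) :
    SupportedMod m (r + s) (f * g) := by
  intro n hn
  rw [coeff_mul]
  refine Finset.sum_eq_zero fun p hp ↦ ?_
  rw [Finset.HasAntidiagonal.mem_antidiagonal] at hp
  by_cases h1 : (p.1 : ZMod m) = r
  · by_cases h2 : (p.2 : ZMod m) = s
    · exact absurd (by rw [← hp, Nat.cast_add, h1, h2]) hn
    · rw [hg _ h2, mul_zero]
  · rw [hf _ h1, zero_mul]

theorem const (a : ℤ) : SupportedMod m 0 (C a) := by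
  intro n hn
  rw [coeff_C, if_neg]
  rintro rfl
  simp at hn

theorem one : SupportedMod m 0 1 := by
  simpa using const (m := m) 1

theorem const_mul (a : ℤ) (hf : SupportedMod m r f) : SupportedMod m r (C a * f) := by
  simpa using (const a).mul hf

theorem pow (hf : SupportedMod m r f) (k : ℕ) : SupportedMod m (k * r) (f ^ k) := by
  induction k with
  | zero => simpa using one
  | succ k ih =>
    rw [pow_succ, Nat.cast_succ, add_mul, one_mul]
    exact ih.mul hf

theorem X_mul_derivative (hf : SupportedMod m r f) :
    SupportedMod m r (X * derivative ℤ f) := by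
  intro n hn
  cases n with
  | zero => simp
  | succ n => rw [coeff_succ_X_mul, coeff_derivative, hf _ hn, zero_mul]

theorem rescale_neg_one {r : ZMod 8} (hf : SupportedMod 8 r f) :
    rescale (-1) f = C ((-1) ^ r.val) * f := by
  ext n
  rw [coeff_rescale, coeff_C_mul]
  by_cases hn : (n : ZMod 8) = r
  · congr 1
    rw [← hn, ZMod.val_natCast, ← Nat.div_add_mod n 8, pow_add, pow_mul]
    norm_num
  · rw [hf n hn, mul_zero, mul_zero]

/-- Dividing by a series with constant coefficient `1` supported on multiples of `m` preserves
divisibility of the coefficients in a residue class modulo `m`. -/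
theorem dvd_coeff_of_dvd_coeff_mul {M : ℤ} (hg : SupportedMod m 0 g)
    (hg1 : constantCoeff g = 1) (h : ∀ n : ℕ, (n : ZMod m) = r → M ∣ coeff n (f * g)) (n : ℕ) :
    (n : ZMod m) = r → M ∣ coeff n f := by
  induction n using Nat.strong_induction_on with
  | _ n ih =>
    intro hn
    have hsum := h n hn
    -- The term at (n, 0) is the wanted coefficient; the others involve earlier coefficients of `f`
    -- in the same class, or vanish.
    rw [coeff_mul, Finset.sum_eq_sum_sdiff_singleton_add (i := (n, 0)) (by simp)] at hsum
    rw [coeff_zero_eq_constantCoeff_apply, hg1, mul_one] at hsum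
    refine (dvd_add_right (Finset.dvd_sum fun p hp ↦ ?_)).1 hsum
    rw [Finset.mem_sdiff, Finset.HasAntidiagonal.mem_antidiagonal, Finset.mem_singleton] at hp
    by_cases h2 : (p.2 : ZMod m) = 0
    · refine (ih p.1 ?_ ?_).mul_right _
      · have : p.2 ≠ 0 := fun h0 ↦ hp.2 (Prod.ext (by omega) h0)
        omega
      · rw [← hn, ← hp.1, Nat.cast_add, h2, add_zero]
    · rw [hg _ h2, mul_zero]
      exact dvd_zero M

end SupportedMod

/-! ### Dissection of θ modulo 8 and the divisibilities -/

theorem supportedMod_squareSeries {m : ℕ} {r : ZMod m} {P : ℕ → Prop}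
    (h : ∀ k, P k → ((k ^ 2 : ℕ) : ZMod m) = r) : SupportedMod m r (squareSeries P) := by
  intro n hn
  rw [squareSeries, coeff_mk, if_neg]
  rintro ⟨k, -, hk, rfl⟩
  exact hn (h k hk)

theorem squareSeries_or {P Q : ℕ → Prop} (h : ∀ k, P k → ¬ Q k) :
    squareSeries (fun k ↦ P k ∨ Q k) = squareSeries P + squareSeries Q := by
  classical
  ext n
  simp only [squareSeries, map_add, coeff_mk]
  by_cases hp : ∃ k, 0 < k ∧ P k ∧ k ^ 2 = n
  · obtain ⟨k, hk, hP, rfl⟩ := hp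
    rw [if_pos ⟨k, hk, Or.inl hP, rfl⟩, if_pos ⟨k, hk, hP, rfl⟩, if_neg, add_zero]
    rintro ⟨l, -, hQ, e⟩
    exact h k hP (Nat.pow_left_injective (n := 2) (by norm_num) e ▸ hQ)
  · rw [if_neg hp, zero_add]
    congr 1
    refine propext ⟨?_, fun ⟨k, hk, hQ, e⟩ ↦ ⟨k, hk, Or.inr hQ, e⟩⟩
    rintro ⟨k, hk, hP | hQ, e⟩
    · exact absurd ⟨k, hk, hP, e⟩ hp
    · exact ⟨k, hk, hQ, e⟩

theorem constantCoeff_squareSeries (P : ℕ → Prop) : constantCoeff (squareSeries P) = 0 := by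
  rw [← coeff_zero_eq_constantCoeff_apply, squareSeries, coeff_mk, if_neg]
  rintro ⟨k, hk, -, e⟩
  exact hk.ne' (by simpa using e)

/-- The dissection of the theta series according to the residue modulo `4` of the square root. -/
theorem thetaSeries_eq : thetaSeries =
    1 + 2 * squareSeries (fun k ↦ k % 4 = 0) + 2 * squareSeries (fun k ↦ k % 4 = 2) +
      2 * squareSeries (fun k ↦ k % 2 = 1) := by
  have h1 : (fun _ : ℕ ↦ True) = fun k ↦ (k % 4 = 0 ∨ k % 4 = 2) ∨ k % 2 = 1 := by
    ext k; simp only [true_iff]; omega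
  rw [thetaSeries, h1, squareSeries_or (fun k h ↦ by omega), squareSeries_or (fun k h ↦ by omega)]
  ring

theorem natCast_sq_zmod_eight_of_odd {k : ℕ} (h : k % 2 = 1) : ((k ^ 2 : ℕ) : ZMod 8) = 1 := by
  have h : k % 8 = 1 ∨ k % 8 = 3 ∨ k % 8 = 5 ∨ k % 8 = 7 := by omega
  rw [← Nat.cast_one, ZMod.natCast_eq_natCast_iff', Nat.pow_mod]
  rcases h with h | h | h | h <;> simp [h]

theorem natCast_sq_zmod_eight_of_mod_four_eq_zero {k : ℕ} (h : k % 4 = 0) :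
    ((k ^ 2 : ℕ) : ZMod 8) = 0 := by
  have h : k % 8 = 0 ∨ k % 8 = 4 := by omega
  rw [← Nat.cast_zero, ZMod.natCast_eq_natCast_iff', Nat.pow_mod]
  rcases h with h | h <;> simp [h]

theorem natCast_sq_zmod_eight_of_mod_four_eq_two {k : ℕ} (h : k % 4 = 2) :
    ((k ^ 2 : ℕ) : ZMod 8) = 4 := by
  have h : k % 8 = 2 ∨ k % 8 = 6 := by omega
  rw [show (4 : ZMod 8) = (4 : ℕ) by rfl, ZMod.natCast_eq_natCast_iff', Nat.pow_mod]
  rcases h with h | h <;> simp [h]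

theorem SupportedMod.of_dvd {m l : ℕ} (h : l ∣ m) {r : ZMod m} {f : ℤ⟦X⟧}
    (hf : SupportedMod m r f) : SupportedMod l (ZMod.castHom h (ZMod l) r) f := by
  intro n hn
  refine hf n fun e ↦ hn ?_
  rw [← e, map_natCast]

/-- Coefficients of `D θ / (θ(X) θ(-X))` in the residue classes `3` modulo `4` and `7` modulo `8`,
where `θ = c + 2 d + 2 b` and the exponents in `c`, `d`, `b` are `0`, `4`, `1` modulo `8`. -/
theorem dvd_coeff_of_dissection {S b c d : ℤ⟦X⟧} (hb : SupportedMod 8 1 b)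
    (hc : SupportedMod 8 0 c) (hd : SupportedMod 8 4 d) (hc1 : constantCoeff c = 1)
    (hd0 : constantCoeff d = 0) (hb0 : constantCoeff b = 0)
    (hS : S * ((c + 2 * d + 2 * b) * (c + 2 * d - 2 * b)) =
      X * derivative ℤ (c + 2 * d + 2 * b)) :
    (∀ n : ℕ, (n : ZMod 4) = 3 → 8 ∣ coeff n S) ∧
      ∀ n : ℕ, (n : ZMod 8) = 7 → 64 ∣ coeff n S := by
  have hDb := hb.X_mul_derivative
  have hDc := hc.X_mul_derivative
  have hDd := hd.X_mul_derivative
  set b' := X * derivative ℤ b with hb'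
  set c' := X * derivative ℤ c with hc'
  set d' := X * derivative ℤ d with hd'
  have hD : X * derivative ℤ (c + 2 * d + 2 * b) = c' + 2 * d' + 2 * b' := by
    simp only [two_mul, map_add, hb', hc', hd', mul_add]
  rw [hD] at hS
  have red {r : ZMod 8} {f : ℤ⟦X⟧} (hf : SupportedMod 8 r f) :=
    hf.of_dvd (show 4 ∣ 8 by norm_num)
  have a4 : SupportedMod 4 0 (c + 2 * d) := by
    rw [← map_ofNat C 2]
    exact (red hc).add ((red hd).const_mul 2)
  have a4' : SupportedMod 4 0 (c' + 2 * d') := by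
    rw [← map_ofNat C 2]
    exact (red hDc).add ((red hDd).const_mul 2)
  have b4 : SupportedMod 4 1 b := red hb
  have b4' : SupportedMod 4 1 b' := red hDb
  have t0 : SupportedMod 4 0 ((c' + 2 * d') * (c + 2 * d) ^ 2) := a4'.mul (a4.pow 2)
  have t1 : SupportedMod 4 1 (C 2 * (b' * (c + 2 * d) ^ 2)) := (b4'.mul (a4.pow 2)).const_mul 2
  have t2 : SupportedMod 4 2 (C 4 * ((c' + 2 * d') * b ^ 2)) := (a4'.mul (b4.pow 2)).const_mul 4
  -- The four summands on the right have exponents 0, 1, 2, 3 modulo 4, in this order.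
  have hS4 : S * ((c + 2 * d) ^ 4 - C 16 * b ^ 4) =
      (c' + 2 * d') * (c + 2 * d) ^ 2 + C 2 * (b' * (c + 2 * d) ^ 2) +
        C 4 * ((c' + 2 * d') * b ^ 2) + C 8 * (b' * b ^ 2) := by
    simp only [map_ofNat]
    linear_combination ((c + 2 * d) ^ 2 + 4 * b ^ 2) * hS
  constructor
  · refine SupportedMod.dvd_coeff_of_dvd_coeff_mul
      (g := (c + 2 * d) ^ 4 - C 16 * b ^ 4) ?_ ?_ ?_
    · exact (a4.pow 4).sub ((b4.pow 4).const_mul 16)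
    · simp [hc1, hd0, hb0]
    · intro n hn
      rw [hS4, map_add, map_add, map_add, t0 n (by rw [hn]; decide), t1 n (by rw [hn]; decide),
        t2 n (by rw [hn]; decide), coeff_C_mul, zero_add, zero_add, zero_add]
      exact dvd_mul_right _ _
  -- Expanded, (c + 2d)⁴ - 16b⁴ = e + 8f, where e and 8f are the parts with exponents 0 and 4 modulo
  -- 8. Multiplying by e - 8f leaves only -64·b'b²f in the class 7, as b'b²e lies in the class 3.
  · set e := c ^ 4 + C 24 * (c ^ 2 * d ^ 2) + C 16 * d ^ 4 with he
    set f := c ^ 3 * d + C 4 * (c * d ^ 3) - C 2 * b ^ 4 with hf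
    have he8 : SupportedMod 8 0 e :=
      ((hc.pow 4).add (((hc.pow 2).mul (hd.pow 2)).const_mul 24)).add ((hd.pow 4).const_mul 16)
    have hf8 : SupportedMod 8 4 f :=
      (((hc.pow 3).mul hd).add ((hc.mul (hd.pow 3)).const_mul 4)).sub ((hb.pow 4).const_mul 2)
    have hef : SupportedMod 4 0 (e - C 8 * f) := (red he8).sub ((red hf8).const_mul 8)
    have u0 := t0.mul hef
    have u1 := t1.mul hef
    have u2 := t2.mul hef
    have u3 : SupportedMod 8 3 (C 8 * (b' * b ^ 2 * e)) :=
      ((hDb.mul (hb.pow 2)).mul he8).const_mul 8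
    have hS8 : S * (e ^ 2 - C 64 * f ^ 2) =
        (c' + 2 * d') * (c + 2 * d) ^ 2 * (e - C 8 * f) +
          C 2 * (b' * (c + 2 * d) ^ 2) * (e - C 8 * f) +
          C 4 * ((c' + 2 * d') * b ^ 2) * (e - C 8 * f) + C 8 * (b' * b ^ 2 * e) +
          C 64 * (-(b' * b ^ 2 * f)) := by
      have hg : (c + 2 * d) ^ 4 - C 16 * b ^ 4 = e + C 8 * f := by
        simp only [he, hf, map_ofNat]
        ring
      rw [hg] at hS4
      simp only [map_ofNat] at hS4 ⊢
      linear_combination (e - 8 * f) * hS4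
    refine SupportedMod.dvd_coeff_of_dvd_coeff_mul (g := e ^ 2 - C 64 * f ^ 2) ?_ ?_ ?_
    · exact (he8.pow 2).sub ((hf8.pow 2).const_mul 64)
    · simp [he, hf, hc1, hd0, hb0]
    · intro n hn
      have hn4 : (n : ZMod 4) = 3 := by
        rw [← map_natCast (ZMod.castHom (show 4 ∣ 8 by norm_num) (ZMod 4)), hn]
        decide
      rw [hS8, map_add, map_add, map_add, map_add, u0 n (by rw [hn4]; decide),
        u1 n (by rw [hn4]; decide), u2 n (by rw [hn4]; decide), u3 n (by rw [hn]; decide),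
        coeff_C_mul, zero_add, zero_add, zero_add, zero_add]
      exact dvd_mul_right _ _

theorem dvd_coeff_of_mul_thetaSeries {S : ℤ⟦X⟧}
    (hS : S * (thetaSeries * rescale (-1) thetaSeries) = X * derivative ℤ thetaSeries) :
    (∀ n : ℕ, (n : ZMod 4) = 3 → 8 ∣ coeff n S) ∧
      ∀ n : ℕ, (n : ZMod 8) = 7 → 64 ∣ coeff n S := by
  have hb : SupportedMod 8 1 (squareSeries fun k ↦ k % 2 = 1) :=
    supportedMod_squareSeries fun k ↦ natCast_sq_zmod_eight_of_odd
  have hc : SupportedMod 8 0 (1 + 2 * squareSeries fun k ↦ k % 4 = 0) := by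
    rw [← map_ofNat C 2]
    exact SupportedMod.one.add ((supportedMod_squareSeries
      fun k ↦ natCast_sq_zmod_eight_of_mod_four_eq_zero).const_mul 2)
  have hd : SupportedMod 8 4 (squareSeries fun k ↦ k % 4 = 2) :=
    supportedMod_squareSeries fun k ↦ natCast_sq_zmod_eight_of_mod_four_eq_two
  refine dvd_coeff_of_dissection hb hc hd (by simp [constantCoeff_squareSeries])
    (constantCoeff_squareSeries _) (constantCoeff_squareSeries _) ?_
  have h : rescale (-1) thetaSeries =
      (1 + 2 * squareSeries fun k ↦ k % 4 = 0) + 2 * (squareSeries fun k ↦ k % 4 = 2) -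
        2 * squareSeries fun k ↦ k % 2 = 1 := by
    rw [thetaSeries_eq, map_add, map_add, map_mul _ 2, map_mul _ 2, map_ofNat,
      hc.rescale_neg_one, hd.rescale_neg_one, hb.rescale_neg_one,
      show (0 : ZMod 8).val = 0 from rfl, show (4 : ZMod 8).val = 4 from rfl,
      show (1 : ZMod 8).val = 1 from rfl, pow_zero, pow_one, map_neg, map_one]
    norm_num
    ring
  rwa [h, thetaSeries_eq] at hS

/-! ### Generating functions weighted by the parity of parts -/

namespace Nat.Partition

variable {R S : Type*} [CommSemiring R] [CommSemiring S]

theorem genFun_congr {f g : ℕ → ℕ → R} (h : ∀ i c, i ≠ 0 → f i c = g i c) :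
    genFun f = genFun g := by
  ext n
  rw [coeff_genFun, coeff_genFun]
  refine Finset.sum_congr rfl fun p _ ↦ Finset.prod_congr rfl fun i hi ↦ h _ _ ?_
  rw [Multiset.toFinsupp_support, Multiset.mem_toFinset] at hi
  exact (p.parts_pos hi).ne'

/-- The generating function splits according to a predicate on the parts. -/
theorem genFun_eq_mul (f : ℕ → ℕ → R) (P : ℕ → Prop) [DecidablePred P] :
    genFun f = genFun (fun i c ↦ if P i then f i c else 0) *
      genFun (fun i c ↦ if P i then 0 else f i c) := by
  let _ : TopologicalSpace R := ⊥
  have _ : DiscreteTopology R := ⟨rfl⟩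
  open scoped PowerSeries.WithPiTopology in
  refine (hasProd_genFun f).unique ?_
  convert! (hasProd_genFun (fun i c ↦ if P i then f i c else 0)).mul
    (hasProd_genFun (fun i c ↦ if P i then 0 else f i c)) using 2 with i
  by_cases h : P (i + 1) <;> simp [h]

/-- Weighting each part by its size rescales the generating function. -/
theorem genFun_pow_mul (w : R) (f : ℕ → ℕ → R) :
    genFun (fun i c ↦ w ^ (c * i) * f i c) = rescale w (genFun f) := by
  ext n
  rw [coeff_rescale, coeff_genFun, coeff_genFun, Finset.mul_sum]
  refine Finset.sum_congr rfl fun p _ ↦ ?_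
  rw [Finsupp.prod_mul]
  congr 1
  rw [Finsupp.prod, Finset.prod_pow_eq_pow_sum, Multiset.toFinsupp_support]
  conv_rhs => rw [← p.parts_sum, Finset.sum_multiset_count]
  simp

theorem genFun_map (g : R →+* S) (f : ℕ → ℕ → R) :
    genFun (fun i c ↦ g (f i c)) = PowerSeries.map g (genFun f) := by
  ext n
  simp [Finsupp.prod]

end Nat.Partition

/-- The generating function of overpartitions with all parts odd. -/
noncomputable def oddOverGenFun : ℤ⟦X⟧ :=
  Nat.Partition.genFun fun i _ ↦ if Odd i then 2 else 0

/-- The generating function of overpartitions with all parts even. -/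
noncomputable def evenOverGenFun : ℤ⟦X⟧ :=
  Nat.Partition.genFun fun i _ ↦ if Odd i then 0 else 2

theorem overlineSOME_eq_sum (n : ℕ) : overlineSOME n = ∑ p : n.Partition,
    2 ^ p.parts.toFinset.card *
      (((p.parts.filter fun i ↦ Odd i).sum : ℤ) - (p.parts.filter fun i ↦ Even i).sum) := by
  rw [overlineSOME, ← Equiv.sum_comp (Overpartition.equivSigma n), Fintype.sum_sigma]
  refine Finset.sum_congr rfl fun p _ ↦ ?_
  simp [Overpartition.equivSigma, Overpartition.sumOddParts, Overpartition.sumEvenParts, mul_sub]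

theorem genFun_parity_weight {R : Type*} [CommSemiring R] (u v : R) :
    Nat.Partition.genFun (fun i c ↦ (if Odd i then u else v) ^ (c * i) * 2) =
      rescale u (Nat.Partition.genFun fun i _ ↦ if Odd i then 2 else 0) *
        rescale v (Nat.Partition.genFun fun i _ ↦ if Odd i then 0 else 2) := by
  rw [Nat.Partition.genFun_eq_mul _ Odd, ← Nat.Partition.genFun_pow_mul,
    ← Nat.Partition.genFun_pow_mul]
  congr 2 <;> ext i c <;> split_ifs <;> simp

theorem Multiset.sum_filter_eq_sum_count (s : Multiset ℕ) (P : ℕ → Prop) [DecidablePred P] :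
    (s.filter P).sum = ∑ i ∈ s.toFinset, if P i then s.count i * i else 0 := by
  rw [Finset.sum_multiset_count, Multiset.toFinset_filter, Finset.sum_filter]
  refine Finset.sum_congr rfl fun i _ ↦ ?_
  split_ifs with h
  · rw [Multiset.count_filter_of_pos h, smul_eq_mul]
  · rfl

theorem coeff_genFun_parity_weight {R : Type*} [CommSemiring R] (u v : R) (n : ℕ) :
    coeff n (Nat.Partition.genFun (fun i c ↦ (if Odd i then u else v) ^ (c * i) * 2)) =
      ∑ p : n.Partition, u ^ (p.parts.filter fun i ↦ Odd i).sum *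
        v ^ (p.parts.filter fun i ↦ Even i).sum * 2 ^ p.parts.toFinset.card := by
  rw [Nat.Partition.coeff_genFun]
  refine Finset.sum_congr rfl fun p _ ↦ ?_
  rw [Finsupp.prod_mul, Multiset.sum_filter_eq_sum_count, Multiset.sum_filter_eq_sum_count,
    ← Finset.prod_pow_eq_pow_sum, ← Finset.prod_pow_eq_pow_sum, ← Finset.prod_mul_distrib]
  simp only [Finsupp.prod, Multiset.toFinsupp_support, Finset.prod_const]
  congr 1
  refine Finset.prod_congr rfl fun i _ ↦ ?_
  by_cases h : Odd i
  · simp [h, Nat.not_even_iff_odd.2 h]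
  · simp [h, Nat.not_odd_iff_even.1 h]

theorem DualNumber.inl_one_add_inr_pow (s : ℤ) (k : ℕ) :
    (TrivSqZeroExt.inl 1 + TrivSqZeroExt.inr s : DualNumber ℤ) ^ k =
      TrivSqZeroExt.inl 1 + TrivSqZeroExt.inr (k * s) := by
  induction k with
  | zero => ext <;> simp
  | succ k ih =>
    rw [pow_succ, ih]
    ext <;> simp
    ring

theorem DualNumber.snd_weight (a b : ℕ) (z : ℤ) :
    ((TrivSqZeroExt.inl 1 + TrivSqZeroExt.inr 1 : DualNumber ℤ) ^ a *
      (TrivSqZeroExt.inl 1 + TrivSqZeroExt.inr (-1)) ^ b * algebraMap ℤ _ z).snd =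
      z * (a - b) := by
  rw [DualNumber.inl_one_add_inr_pow, DualNumber.inl_one_add_inr_pow]
  simp
  ring

/-- The generating function of `overlineSOME`. -/
theorem mk_overlineSOME : PowerSeries.mk overlineSOME =
    X * derivative ℤ oddOverGenFun * evenOverGenFun -
      oddOverGenFun * (X * derivative ℤ evenOverGenFun) := by
  have hX (f : ℤ⟦X⟧) (n : ℕ) : coeff n (X * derivative ℤ f) = n * coeff n f := by
    cases n with
    | zero => simp
    | succ n => rw [coeff_succ_X_mul, coeff_derivative, mul_comm, Nat.cast_succ]
  ext n
  -- With weights 1 + ε on odd and 1 - ε on even parts, the coefficient of ε is the odd sum minus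
  -- the even sum.
  have h := congrArg TrivSqZeroExt.snd ((coeff_genFun_parity_weight
    (TrivSqZeroExt.inl 1 + TrivSqZeroExt.inr 1 : DualNumber ℤ)
    (TrivSqZeroExt.inl 1 + TrivSqZeroExt.inr (-1)) n).symm.trans
      (congrArg (coeff n) (genFun_parity_weight _ _)))
  have ho : (Nat.Partition.genFun fun i _ ↦ if Odd i then 2 else 0 : (DualNumber ℤ)⟦X⟧) =
      PowerSeries.map (algebraMap ℤ _) oddOverGenFun := by
    rw [oddOverGenFun, ← Nat.Partition.genFun_map]
    congr 1; ext1 i; ext1; split_ifs <;> simp only [map_ofNat, map_zero]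
  have he : (Nat.Partition.genFun fun i _ ↦ if Odd i then 0 else 2 : (DualNumber ℤ)⟦X⟧) =
      PowerSeries.map (algebraMap ℤ _) evenOverGenFun := by
    rw [evenOverGenFun, ← Nat.Partition.genFun_map]
    congr 1; ext1 i; ext1; split_ifs <;> simp only [map_ofNat, map_zero]
  have h2 (k : ℕ) : (2 : DualNumber ℤ) ^ k = algebraMap ℤ _ (2 ^ k) := by
    rw [map_pow, map_ofNat]
  rw [ho, he, coeff_mul, TrivSqZeroExt.snd_sum, TrivSqZeroExt.snd_sum] at h
  rw [coeff_mk, overlineSOME_eq_sum, map_sub, coeff_mul, coeff_mul, ← Finset.sum_sub_distrib]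
  refine Eq.trans (Finset.sum_congr rfl fun p _ ↦ ?_)
    (h.trans (Finset.sum_congr rfl fun p _ ↦ ?_))
  · rw [h2, DualNumber.snd_weight]
  · rw [coeff_rescale, coeff_rescale, coeff_map, coeff_map, mul_mul_mul_comm, ← map_mul,
      DualNumber.snd_weight, hX, hX]
    ring

/-! ### Product formulas and the theta quotient -/

section Products

open scoped PowerSeries.WithPiTopology

theorem one_add_tsum_mul_one_sub {R : Type*} [CommRing R] [TopologicalSpace R] [T2Space R]
    [IsTopologicalRing R] {k : ℕ} (hk : k ≠ 0) (s : R) :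
    (1 + ∑' j : ℕ, (s ^ (j + 1) * 2) • (X : R⟦X⟧) ^ (k * (j + 1))) * (1 - C s * X ^ k) =
      1 + C s * X ^ k := by
  have h0 : constantCoeff (C s * X ^ k : R⟦X⟧) = 0 := by simp [hk]
  have hs := WithPiTopology.tsum_pow_mul_one_sub_of_constantCoeff_eq_zero h0
  have e : (fun j : ℕ ↦ (s ^ (j + 1) * 2) • (X : R⟦X⟧) ^ (k * (j + 1))) =
      fun j ↦ (C 2 * (C s * X ^ k)) * (C s * X ^ k) ^ j := by
    ext1 j
    rw [smul_eq_C_mul, map_mul, map_pow, pow_mul]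
    ring
  rw [e, (WithPiTopology.summable_pow_of_constantCoeff_eq_zero h0).tsum_mul_left, map_ofNat]
  linear_combination (2 * (C s * X ^ k)) * hs

theorem rescale_neg_one_evenOverGenFun : rescale (-1) evenOverGenFun = evenOverGenFun := by
  rw [evenOverGenFun, ← Nat.Partition.genFun_pow_mul]
  refine Nat.Partition.genFun_congr fun i c _ ↦ ?_
  split_ifs with h
  · rw [mul_zero]
  · rw [((Nat.not_odd_iff_even.1 h).mul_left c).neg_one_pow, one_mul]

/-- Each factor (1 + X^i)/(1 - X^i) with i odd is inverted by replacing X with -X. -/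
theorem oddOverGenFun_mul_rescale : oddOverGenFun * rescale (-1) oddOverGenFun = 1 := by
  rw [oddOverGenFun, ← Nat.Partition.genFun_pow_mul]
  refine ((Nat.Partition.hasProd_genFun _).mul (Nat.Partition.hasProd_genFun _)).unique ?_
  convert! hasProd_one (α := ℤ⟦X⟧) using 2 with i
  by_cases h : Odd (i + 1)
  · have h1 := one_add_tsum_mul_one_sub i.succ_ne_zero (1 : ℤ)
    have h2 := one_add_tsum_mul_one_sub i.succ_ne_zero (-1 : ℤ)
    have e (j : ℕ) : (-1 : ℤ) ^ ((j + 1) * (i + 1)) * 2 = (-1) ^ (j + 1) * 2 := by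
      rw [mul_comm (j + 1), pow_mul, h.neg_one_pow]
    simp only [h, if_true, e]
    simp only [one_pow, one_mul, map_one, map_neg, neg_one_mul, sub_neg_eq_add] at h1 h2
    have hn : ((1 - X ^ (i + 1)) * (1 + X ^ (i + 1)) : ℤ⟦X⟧) ≠ 0 := by
      refine mul_ne_zero ?_ (one_add_X_pow_ne_zero i.succ_ne_zero)
      intro h
      simpa using congrArg constantCoeff h
    refine mul_right_cancel₀ hn ?_
    calc _ = _ := mul_mul_mul_comm _ _ _ _
      _ = (1 + X ^ (i + 1)) * (1 + -X ^ (i + 1)) := congrArg₂ (· * ·) h1 h2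
      _ = _ := by ring
  · simp only [h, if_false, mul_zero]
    simp [smul_eq_C_mul]

theorem oddOverGenFun_mul_evenOverGenFun :
    oddOverGenFun * evenOverGenFun = Nat.Partition.genFun fun _ _ ↦ 2 :=
  (Nat.Partition.genFun_eq_mul (fun _ _ ↦ 2) Odd).symm

/-- Gauss's identity: the generating function of overpartitions is the inverse of `θ(-X)`. -/
theorem genFun_two_mul_rescale_thetaSeries :
    Nat.Partition.genFun (fun _ _ ↦ 2) * rescale (-1) thetaSeries = 1 := by
  have h1 := (Nat.Partition.hasProd_genFun (fun _ _ ↦ (2 : ℤ))).tendsto_prod_nat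
  have h2 : Filter.Tendsto
      (fun N ↦ ∏ i ∈ Finset.range N, ((1 - X ^ (i + 1)) * invOneAddXPow (i + 1)))
      Filter.atTop (nhds (rescale (-1) thetaSeries)) := by
    rw [WithPiTopology.tendsto_iff_coeff_tendsto]
    exact fun n ↦ tendsto_atTop_of_eventually_const (i₀ := n + 1)
      fun N hN ↦ coeff_prod_one_sub_mul_inv hN
  refine tendsto_nhds_unique (h1.mul h2) ?_
  convert! tendsto_const_nhds (α := ℕ) (x := (1 : ℤ⟦X⟧)) using 2 with N
  rw [← Finset.prod_mul_distrib]
  refine Finset.prod_eq_one fun i _ ↦ ?_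
  have h := one_add_tsum_mul_one_sub i.succ_ne_zero (1 : ℤ)
  simp only [one_pow, one_mul, map_one] at h
  rw [← mul_assoc, h, one_add_X_pow_mul_inv i.succ_ne_zero]

end Products

theorem mk_overlineSOME_mul_thetaSeries :
    PowerSeries.mk overlineSOME * (thetaSeries * rescale (-1) thetaSeries) =
      X * derivative ℤ thetaSeries := by
  have h1 := genFun_two_mul_rescale_thetaSeries
  rw [← oddOverGenFun_mul_evenOverGenFun] at h1
  have h2 := congrArg (rescale (-1)) h1
  rw [map_mul, map_mul, rescale_rescale, rescale_neg_one_evenOverGenFun, neg_one_mul, neg_neg,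
    rescale_one, RingHom.id_apply, map_one] at h2
  have h3 : oddOverGenFun = thetaSeries * evenOverGenFun := by
    -- `h2` reads O(-X)·E·θ = 1; multiplying by O cancels O(-X).
    linear_combination (-oddOverGenFun) * h2 +
      evenOverGenFun * thetaSeries * oddOverGenFun_mul_rescale
  have h4 := congrArg (derivative ℤ) h3
  rw [Derivation.leibniz, smul_eq_mul, smul_eq_mul] at h4
  rw [mk_overlineSOME, h4]
  rw [h3] at h1 ⊢
  linear_combination (X * derivative ℤ thetaSeries) * h1

theorem theorem4 (n : ℕ) :
    overlineSOME (4 * n + 3) ≡ 0 [ZMOD 8] ∧ overlineSOME (8 * n + 7) ≡ 0 [ZMOD 64] := by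
  obtain ⟨h4, h8⟩ := dvd_coeff_of_mul_thetaSeries mk_overlineSOME_mul_thetaSeries
  have e4 : (4 : ZMod 4) = 0 := by decide
  have e8 : (8 : ZMod 8) = 0 := by decide
  rw [Int.modEq_zero_iff_dvd, Int.modEq_zero_iff_dvd]
  have h := h4 (4 * n + 3) (by push_cast; rw [e4, zero_mul, zero_add])
  have h' := h8 (8 * n + 7) (by push_cast; rw [e8, zero_mul, zero_add])
  rw [coeff_mk] at h h'
  exact ⟨h, h'⟩
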